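/- Let $f:X\to S$ be a morphism of schemes. Let $\mathrm{Rel}(f)\subseteq S$ (resp. $\mathrm{QRel}(f)\subseteq S$) be the set of all points $f(x)$, where $x\in X$ is a point such that the residue field extension $\kappa(f(x))\subseteq\kappa(x)$ is trivial (resp. purely inseparable). A scheme $S$ is called a Poonen scheme if, for every nonempty open subscheme $U\subseteq S$ and every dominant morphism of finite presentation $f:X\to U$, the set $\mathrm{QRel}(f)$ is nonempty. A commutative ring $A$ is called a Poonen ring if $\operatorname{Spec}A$ is a Poonen scheme. Let $A$ be an integral domain with fraction field $K$. A polynomial $F\in A[Y]$ is called separable if its image in $K[Y]$ is a separable polynomial (that is, coprime to its derivative). Then $A$ is a Poonen ring if and only if, for every nonconstant separable polynomial $F\in A[Y]$, the set $\mathrm{Rel}\bigl(\operatorname{Spec}(A[Y]/(F))\to\operatorname{Spec}A\bigr)$ is dense in $\operatorname{Spec}A$. -/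

import Mathlib

open AlgebraicGeometry CategoryTheory

universe u

namespace PoonenScheme

/-- The points `x` of `X` whose residue field is a purely inseparable extension of the
residue field of `f x`. -/
def QRelPts {X S : Scheme.{u}} (f : X ⟶ S) : Set X :=
  {x | (f.residueFieldMap x).hom.IsPurelyInseparable}

/-- The points `x` of `X` whose residue field is a trivial extension of the residue field
of `f x`. -/
def RelPts {X S : Scheme.{u}} (f : X ⟶ S) : Set X :=
  {x | Function.Bijective (f.residueFieldMap x).hom}

/-- The points of `S` that are quasi-liftable to `X`: the image of `QRelPts f`. -/
def QRelSet {X S : Scheme.{u}} (f : X ⟶ S) : Set S := f '' QRelPts f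

/-- The points of `S` that are liftable to `X`: the image of `RelPts f`. -/
def RelSet {X S : Scheme.{u}} (f : X ⟶ S) : Set S := f '' RelPts f

/-- Morphisms of finite presentation: locally of finite presentation, quasi-compact and
quasi-separated. -/
structure IsFinitelyPresented {X S : Scheme.{u}} (f : X ⟶ S) : Prop where
  locallyOfFinitePresentation : LocallyOfFinitePresentation f
  quasiCompact : QuasiCompact f
  quasiSeparated : QuasiSeparated f

/-- A scheme `S` is a Poonen scheme if for every nonempty open `U ⊆ S` and every dominant
`U`-scheme `f : X ⟶ U` of finite presentation, the set `QRelSet f` is nonempty. -/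
def IsPoonenScheme (S : Scheme.{u}) : Prop :=
  ∀ U : S.Opens, (U : Set S).Nonempty → ∀ (X : Scheme.{u}) (f : X ⟶ (U : Scheme.{u})),
    IsFinitelyPresented f → IsDominant f → (QRelSet f).Nonempty

/-- A ring `A` is a Poonen ring if `Spec A` is a Poonen scheme. -/
def IsPoonenRing (A : Type u) [CommRing A] : Prop :=
  IsPoonenScheme (Spec (CommRingCat.of A))

/-- The structure morphism `Spec (A[Y]/(F)) ⟶ Spec A`. -/
noncomputable def hypersurfaceMap {A : Type u} [CommRing A] (F : Polynomial A) :
    Spec (CommRingCat.of (AdjoinRoot F)) ⟶ Spec (CommRingCat.of A) :=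
  Spec.map (CommRingCat.ofHom (AdjoinRoot.of F))

/-- A polynomial over a domain `A` is (generically) separable if its image over the fraction
field of `A` is a separable polynomial, i.e. coprime to its derivative. -/
def IsSeparablePoly {A : Type u} [CommRing A] [IsDomain A] (F : Polynomial A) : Prop :=
  (F.map (algebraMap A (FractionRing A))).Separable

end PoonenScheme

namespace PoonenScheme

open Polynomial

/-! If `A` is Poonen, a Bezout relation `u * F + v * F' = b` with `b ≠ 0` makes `F` separable at
every point of `D(b)`. A quasi-liftable point found in `D(c * b)` has residue extension generated by
a root of `F`, which is both separable and purely inseparable, hence trivial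
(`mem_relPts_of_mem_qRelPts`).

Conversely, shrinking reduces to a finite type `A`-algebra `B` containing `A`. Its generic fibre has
a point in a finite extension `L` of `K = Frac A`, and `L` is purely inseparable over some `K(α)`
with `α` separable. Clearing denominators in the minimal polynomial of `α` gives `F`. A liftable
point of `A[Y]/(F)`, off a suitable nonzero constant, extends to a place of `L`. This place is
finite on `B`, because some `p`-power of each generator is a polynomial in `α` with invertible
denominator; for the same reason it sends `B` into the perfect closure of the residue field of the
base point (`exists_hom_purelyInseparable`). -/

lemma isPurelyInseparable_ringHom_iff_pow_mem {F E : Type*} [Field F] [Field E] (φ : F →+* E)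
    (q : ℕ) [ExpChar F q] :
    φ.IsPurelyInseparable ↔ ∀ x : E, ∃ n : ℕ, x ^ q ^ n ∈ φ.range := by
  algebraize [φ]
  exact _root_.isPurelyInseparable_iff_pow_mem F q

lemma isPurelyInseparable_comp_iff_of_bijective {F F' E : Type*} [Field F] [Field F'] [Field E]
    (φ : F' →+* E) (i : F →+* F') (hi : Function.Bijective i) :
    (φ.comp i).IsPurelyInseparable ↔ φ.IsPurelyInseparable := by
  obtain ⟨q, _⟩ := ExpChar.exists F
  have : ExpChar F' q := (i.expChar_iff hi.1 q).mp inferInstance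
  have hr : (φ.comp i).range = φ.range := SetLike.coe_injective <| by
    rw [RingHom.coe_range, RingHom.coe_range, RingHom.coe_comp, hi.2.range_comp]
  rw [isPurelyInseparable_ringHom_iff_pow_mem _ q, isPurelyInseparable_ringHom_iff_pow_mem _ q, hr]

/-! ### Residue fields and field-valued points over an affine base -/

instance isPrime_asIdeal {R : CommRingCat.{u}} (s : Spec R) : s.asIdeal.IsPrime := s.isPrime

/-- The evaluation homomorphism from a ring to the residue field of a point of its spectrum. -/
noncomputable def specEval {R : CommRingCat.{u}} (s : Spec R) : R ⟶ (Spec R).residueField s :=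
  (Scheme.ΓSpecIso R).inv ≫ (Spec R).Γevaluation s

lemma specEval_eq {R : CommRingCat.{u}} (s : Spec R) :
    specEval s = CommRingCat.ofHom (algebraMap R s.asIdeal.ResidueField) ≫
      (Scheme.Spec.residueFieldIso R s).inv := by
  rw [Scheme.Spec.algebraMap_residueFieldIso_inv]; rfl

lemma specMap_specEval {R : CommRingCat.{u}} (s : Spec R) :
    Spec.map (specEval s) = (Spec R).fromSpecResidueField s := by
  rw [specEval_eq, Spec.map_comp, Scheme.Spec.map_residueFieldIso_inv_eq_fromSpecResidueField]

lemma exists_specEval_mul_eq {R : CommRingCat.{u}} (s : Spec R) (w : (Spec R).residueField s) :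
    ∃ a b : R, (specEval s).hom b ≠ 0 ∧ w * (specEval s).hom b = (specEval s).hom a := by
  let e := (Scheme.Spec.residueFieldIso R s).commRingCatIsoToRingEquiv
  have key : ∀ r, (specEval s).hom r = e.symm (algebraMap R s.asIdeal.ResidueField r) := fun r ↦ by
    rw [specEval_eq]; rfl
  obtain ⟨a, b, hb, h⟩ := IsFractionRing.div_surjective (A := R ⧸ s.asIdeal) (e w)
  obtain ⟨a, rfl⟩ := Ideal.Quotient.mk_surjective a
  obtain ⟨b, rfl⟩ := Ideal.Quotient.mk_surjective b
  have hb' : algebraMap R s.asIdeal.ResidueField b ≠ 0 := by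
    intro h0
    apply nonZeroDivisors.ne_zero hb
    apply IsFractionRing.injective (R ⧸ s.asIdeal) s.asIdeal.ResidueField
    rw [map_zero, ← h0]; rfl
  refine ⟨a, b, ?_, ?_⟩
  · rw [key]; simpa using hb'
  · rw [key, key]
    apply e.injective
    simp only [map_mul, RingEquiv.apply_symm_apply]
    rw [← h]
    exact div_mul_cancel₀ _ hb'

lemma specEval_comp_residueFieldMap {R R' : CommRingCat.{u}} (φ : R ⟶ R') (y : Spec R') :
    specEval (Spec.map φ y) ≫ (Spec.map φ).residueFieldMap y = φ ≫ specEval y := by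
  rw [← Spec.map_inj, Spec.map_comp, Spec.map_comp, specMap_specEval, specMap_specEval,
    Scheme.Hom.SpecMap_residueFieldMap_fromSpecResidueField]

lemma specEval_ne_zero_iff {R : CommRingCat.{u}} (s : Spec R) (r : R) :
    (specEval s).hom r ≠ 0 ↔ r ∉ s.asIdeal := by
  have key : (specEval s).hom r = (Scheme.Spec.residueFieldIso R s).commRingCatIsoToRingEquiv.symm
      (algebraMap R s.asIdeal.ResidueField r) := by
    rw [specEval_eq]; rfl
  rw [key, ne_eq, EmbeddingLike.map_eq_zero_iff, Ideal.algebraMap_residueField_eq_zero]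

/-- A field-valued point determines a homomorphism from the residue field at its image; over an
affine base it recovers the underlying ring homomorphism. -/
lemma exists_residueField_hom {X : Scheme.{u}} {R : CommRingCat.{u}} (f : X ⟶ Spec R)
    {Ω : Type u} [Field Ω] (g : Spec (.of Ω) ⟶ X) (ψ : R ⟶ .of Ω) (h : g ≫ f = Spec.map ψ) :
    ∃ (x : X) (δ : X.residueField x ⟶ .of Ω),
      specEval (f x) ≫ f.residueFieldMap x ≫ δ = ψ := by
  refine ⟨g (IsLocalRing.closedPoint Ω),
    X.descResidueField (Scheme.stalkClosedPointTo g), ?_⟩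
  rw [← Spec.map_inj, Spec.map_comp, Spec.map_comp, specMap_specEval, Category.assoc,
    Scheme.Hom.SpecMap_residueFieldMap_fromSpecResidueField,
    ← Category.assoc, Scheme.descResidueField_stalkClosedPointTo_fromSpecResidueField, h]

lemma qRelPts_comp_openImmersion {X S T : Scheme.{u}} (f : X ⟶ S) (i : S ⟶ T)
    [IsOpenImmersion i] : QRelPts (f ≫ i) = QRelPts f := by
  ext x
  have hi : Function.Bijective (i.residueFieldMap (f x)).hom :=
    (ConcreteCategory.isIso_iff_bijective (i.residueFieldMap (f x))).mp inferInstance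
  change ((f ≫ i).residueFieldMap x).hom.IsPurelyInseparable ↔
    (f.residueFieldMap x).hom.IsPurelyInseparable
  rw [Scheme.residueFieldMap_comp]
  exact isPurelyInseparable_comp_iff_of_bijective _ _ hi

/-- A field-valued point, purely inseparable over the field generated by the base, detects a
quasi-liftable point. -/
lemma qRelPts_nonempty_of_fieldPoint {X : Scheme.{u}} {R : CommRingCat.{u}} (f : X ⟶ Spec R)
    {Ω : Type u} [Field Ω] (p : ℕ) [ExpChar Ω p] (g : Spec (.of Ω) ⟶ X) (ψ : R ⟶ .of Ω)
    (h : g ≫ f = Spec.map ψ)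
    (hψ : ∀ w : Ω, ∃ (n : ℕ) (a b : R), ψ.hom b ≠ 0 ∧ w ^ p ^ n * ψ.hom b = ψ.hom a) :
    (QRelPts f).Nonempty := by
  obtain ⟨x, δ, hδ⟩ := exists_residueField_hom f g ψ h
  refine ⟨x, ?_⟩
  let _ : Algebra ((Spec R).residueField (f x)) (X.residueField x) :=
    (f.residueFieldMap x).hom.toAlgebra
  let _ : Algebra (X.residueField x) Ω := δ.hom.toAlgebra
  let _ : Algebra ((Spec R).residueField (f x)) Ω :=
    (δ.hom.comp (f.residueFieldMap x).hom).toAlgebra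
  have : IsScalarTower ((Spec R).residueField (f x)) (X.residueField x) Ω := .of_algebraMap_eq' rfl
  have hpi : IsPurelyInseparable ((Spec R).residueField (f x)) Ω := by
    have : ExpChar ((Spec R).residueField (f x)) p :=
      (algebraMap ((Spec R).residueField (f x)) Ω).expChar (RingHom.injective _) p
    rw [isPurelyInseparable_iff_pow_mem _ p]
    intro w
    obtain ⟨n, a, b, hb, hw⟩ := hψ w
    refine ⟨n, (specEval (f x)).hom a / (specEval (f x)).hom b, ?_⟩
    have key : ∀ r, algebraMap ((Spec R).residueField (f x)) Ω ((specEval (f x)).hom r) =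
      ψ.hom r := fun r ↦ by rw [← hδ]; rfl
    rw [map_div₀, key, key, ← hw, mul_div_cancel_right₀ _ hb]
  exact IsPurelyInseparable.tower_bot _ (X.residueField x) Ω

/-! ### Pseudo-division, separable generators and places -/

/-- Divisibility by `F` over `K` need not descend to `A`, but pseudo-division only multiplies by
powers of the leading coefficient, which `ψ` does not kill. -/
lemma eq_zero_of_map_dvd_map {A K κ : Type*} [CommRing A] [IsDomain A] [Field K] [Algebra A K]
    [IsFractionRing A K] [CommRing κ] [IsDomain κ] {F : A[X]} (hF : F.natDegree ≠ 0)
    (ψ : A[X] →+* κ) (hψ : ψ F = 0) (hlc : ψ (C F.leadingCoeff) ≠ 0) (P : A[X])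
    (hP : F.map (algebraMap A K) ∣ P.map (algebraMap A K)) : ψ P = 0 := by
  have hinj : Function.Injective (algebraMap A K) := IsFractionRing.injective A K
  induction hn : P.natDegree using Nat.strong_induction_on generalizing P with
  | _ n ih =>
    subst hn
    rcases eq_or_ne P 0 with rfl | hP0
    · exact map_zero ψ
    have hle : F.natDegree ≤ P.natDegree := by
      rw [← natDegree_map_eq_of_injective hinj F, ← natDegree_map_eq_of_injective hinj P]
      exact natDegree_le_of_dvd hP ((Polynomial.map_ne_zero_iff hinj).mpr hP0)
    have hc : ψ (F.cancelLeads P) = 0 := by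
      refine ih _ (natDegree_cancelLeads_lt_of_natDegree_le_natDegree hle (by omega)) _ ?_ rfl
      rw [cancelLeads, Polynomial.map_sub, Polynomial.map_mul, Polynomial.map_mul (q := F)]
      exact dvd_sub (hP.mul_left _) (dvd_mul_left _ _)
    rw [cancelLeads, Nat.sub_eq_zero_of_le hle, pow_zero, mul_one, map_sub, map_mul, map_mul, hψ,
      mul_zero, sub_zero] at hc
    exact (mul_eq_zero.mp hc).resolve_left hlc

/-- A finite field extension is purely inseparable over a simple separable subextension. -/
lemma exists_isSeparable_forall_pow_mem (K L : Type*) [Field K] [Field L] [Algebra K L]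
    [FiniteDimensional K L] (p : ℕ) [ExpChar K p] :
    ∃ α : L, IsSeparable K α ∧ ∀ x : L, ∃ (n : ℕ) (P : K[X]), x ^ p ^ n = aeval α P := by
  obtain ⟨α, hα⟩ := Field.exists_primitive_element K (separableClosure K L)
  refine ⟨α, mem_separableClosure_iff.mp α.2, fun x ↦ ?_⟩
  have : ExpChar (separableClosure K L) p :=
    expChar_of_injective_algebraMap (algebraMap K _).injective p
  obtain ⟨n, y, hy⟩ := IsPurelyInseparable.pow_mem (separableClosure K L) p x
  have hmem : y ∈ IntermediateField.adjoin K {α} := hα ▸ IntermediateField.mem_top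
  rw [← IntermediateField.mem_toSubalgebra,
    IntermediateField.adjoin_simple_toSubalgebra_of_isAlgebraic (Algebra.IsAlgebraic.isAlgebraic α),
    Algebra.adjoin_singleton_eq_range_aeval] at hmem
  obtain ⟨P, rfl⟩ := hmem
  refine ⟨n, P, ?_⟩
  rw [← hy]
  exact (aeval_algebraMap_apply L α P).symm

/-- Extension of places: a homomorphism from a ring to a field which factors through the image in
a field `L` is dominated by a valuation ring of `L`. -/
lemma exists_valuationSubring_forall_mem {R L κ : Type*} [CommRing R] [Field L] [Field κ]
    (g : R →+* L) (ψ : R →+* κ) (h : ∀ r, g r = 0 → ψ r = 0) :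
    ∃ (V : ValuationSubring L) (hV : ∀ r, g r ∈ V),
      ∀ r, IsLocalRing.residue V ⟨g r, hV r⟩ = 0 ↔ ψ r = 0 := by
  have : (RingHom.ker ψ).IsPrime := RingHom.ker_isPrime ψ
  let f : Localization.AtPrime (RingHom.ker ψ) →+* L :=
    IsLocalization.lift (M := (RingHom.ker ψ).primeCompl) (g := g)
      fun y ↦ isUnit_iff_ne_zero.mpr fun hy ↦ y.2 (h _ hy)
  have hf : ∀ r, f (algebraMap R _ r) = g r := fun r ↦ IsLocalization.lift_eq _ r
  obtain ⟨V, hV, hloc⟩ := IsLocalRing.exists_factor_valuationRing f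
  refine ⟨V, fun r ↦ hf r ▸ hV _, fun r ↦ ?_⟩
  rw [IsLocalRing.residue_eq_zero_iff, IsLocalRing.mem_maximalIdeal, mem_nonunits_iff,
    not_iff_comm]
  have he : (⟨g r, hf r ▸ hV _⟩ : V) = f.codRestrict V.toSubring hV (algebraMap R _ r) :=
    Subtype.ext (hf r).symm
  rw [he]
  have := isUnit_map_iff (f.codRestrict V.toSubring hV) (algebraMap R _ r)
  refine Iff.trans ?_ this.symm
  rw [IsLocalization.AtPrime.isUnit_to_map_iff _ (RingHom.ker ψ)]
  rfl

lemma ValuationSubring.mem_of_pow_mem {L : Type*} [Field L] (V : ValuationSubring L) {x : L}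
    {n : ℕ} (hn : n ≠ 0) (h : x ^ n ∈ V) : x ∈ V := by
  rw [← V.valuation_le_one_iff] at h ⊢
  rw [map_pow] at h
  exact (pow_le_one_iff hn).mp h

/-- The exponent `p` belongs to `V`, not to its residue field. In mixed characteristic `p = 1` and
the power is trivial; otherwise both characteristics equal `p`. -/
lemma mem_perfectClosure_of_pow_mem {V k : Type*} [CommRing V] [IsLocalRing V]
    (p : ℕ) [ExpChar V p] [Field k] [Algebra k (IsLocalRing.ResidueField V)] (x : V) (n : ℕ)
    (h : IsLocalRing.residue V x ^ p ^ n ∈ (algebraMap k (IsLocalRing.ResidueField V)).range) :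
    IsLocalRing.residue V x ∈ perfectClosure k (IsLocalRing.ResidueField V) := by
  rcases ‹ExpChar V p› with _ | hp
  · rw [one_pow, pow_one] at h
    obtain ⟨y, hy⟩ := h
    exact hy ▸ (perfectClosure k _).algebraMap_mem y
  · have h0 : (p : IsLocalRing.ResidueField V) = 0 := by
      rw [← map_natCast (IsLocalRing.residue V), CharP.cast_eq_zero, map_zero]
    have : CharP (IsLocalRing.ResidueField V) p := (CharP.charP_iff_prime_eq_zero hp).mpr h0
    have : ExpChar (IsLocalRing.ResidueField V) p := .prime hp
    have : ExpChar k p := (algebraMap k (IsLocalRing.ResidueField V)).expChar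
      (RingHom.injective _) p
    rw [mem_perfectClosure_iff_pow_mem p]
    exact ⟨n, h⟩

/-! ### From the generic fibre to a purely inseparable point -/

/-- The generic fibre `K ⊗ B` is nonzero by flatness of `K`, and the Nullstellensatz makes its
residue field at a maximal ideal finite over `K`. -/
lemma exists_finite_algHom_field {A B : Type u} [CommRing A] [IsDomain A] [CommRing B]
    [Algebra A B] [Algebra.FiniteType A B] (hinj : Function.Injective (algebraMap A B)) :
    ∃ (L : Type u) (_ : Field L) (_ : Algebra A L) (_ : Algebra (FractionRing A) L)
      (_ : IsScalarTower A (FractionRing A) L), Module.Finite (FractionRing A) L ∧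
      Nonempty (B →ₐ[A] L) := by
  let K := FractionRing A
  have : Nontrivial (TensorProduct A K B) :=
    (Algebra.TensorProduct.includeLeft_injective (S := A) (A := K) (B := B) hinj).nontrivial
  obtain ⟨m, hm⟩ := Ideal.exists_maximal (TensorProduct A K B)
  let := Ideal.Quotient.field m
  have : Module.Finite K (TensorProduct A K B ⧸ m) :=
    finite_of_finite_type_of_isJacobsonRing K (TensorProduct A K B ⧸ m)
  exact ⟨TensorProduct A K B ⧸ m, inferInstance, inferInstance, inferInstance, inferInstance, this,
    ⟨(Ideal.Quotient.mkₐ A m).comp Algebra.TensorProduct.includeRight⟩⟩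

lemma exists_integer_polynomial_smul {A K : Type*} [CommRing A] [IsDomain A] [Field K] [Algebra A K]
    [IsFractionRing A K] (P : K[X]) :
    ∃ (d : A) (u : A[X]), d ≠ 0 ∧ u.map (algebraMap A K) = d • P := by
  obtain ⟨d, hd, h⟩ := IsLocalization.integerNormalization_spec (nonZeroDivisors A) P
  exact ⟨d, _, nonZeroDivisors.ne_zero hd, h⟩

/-- If `A[Y]/(F)` has points with trivial residue extension away from any prescribed nonzero
element, for all separable `F`, then every finitely generated extension of `A` has a point with
purely inseparable residue extension. -/
lemma exists_hom_purelyInseparable {A B : Type u} [CommRing A] [IsDomain A] [CommRing B]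
    [Algebra A B] [Algebra.FiniteType A B] (hinj : Function.Injective (algebraMap A B))
    (H : ∀ F : A[X], F.natDegree ≠ 0 → IsSeparablePoly F → ∀ c : A, c ≠ 0 →
      ∃ (κ : Type u) (_ : Field κ) (ψ : AdjoinRoot F →+* κ), ψ (AdjoinRoot.of F c) ≠ 0 ∧
        ∀ w : κ, ∃ a b : A, ψ (AdjoinRoot.of F b) ≠ 0 ∧
          w * ψ (AdjoinRoot.of F b) = ψ (AdjoinRoot.of F a)) :
    ∃ (Ω : Type u) (_ : Field Ω) (p : ℕ) (_ : ExpChar Ω p) (φ : B →+* Ω),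
      ∀ w : Ω, ∃ (n : ℕ) (a b : A), φ (algebraMap A B b) ≠ 0 ∧
        w ^ p ^ n * φ (algebraMap A B b) = φ (algebraMap A B a) := by
  classical
  obtain ⟨L, _, _, _, _, _, ⟨β⟩⟩ := exists_finite_algHom_field hinj
  let K := FractionRing A
  have hAK : Function.Injective (algebraMap A K) := IsFractionRing.injective A K
  obtain ⟨p, _⟩ := ExpChar.exists K
  obtain ⟨α, hα, hpow⟩ := exists_isSeparable_forall_pow_mem K L p
  have hint : IsIntegral K α := Algebra.IsIntegral.isIntegral α
  obtain ⟨b, F, hb, hF⟩ := exists_integer_polynomial_smul (A := A) (minpoly K α)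
  have hbK : algebraMap A K b ≠ 0 := (map_ne_zero_iff _ hAK).mpr hb
  have hF' : F.map (algebraMap A K) = C (algebraMap A K b) * minpoly K α := by
    rw [hF, ← smul_eq_C_mul, algebraMap_smul]
  have hunit : IsUnit (C (algebraMap A K b)) := isUnit_C.mpr (isUnit_iff_ne_zero.mpr hbK)
  have hFdeg : F.natDegree ≠ 0 := by
    rw [← natDegree_map_eq_of_injective hAK, hF', natDegree_C_mul hbK]
    exact (minpoly.natDegree_pos hint).ne'
  have hF0 : F ≠ 0 := by rintro rfl; exact hFdeg natDegree_zero
  have hFsep : IsSeparablePoly F := by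
    rw [IsSeparablePoly, hF']
    exact Separable.unit_mul hunit hα
  have hden : ∀ x : L, ∃ (d : A) (n : ℕ) (u : A[X]), d ≠ 0 ∧
      algebraMap A L d * x ^ p ^ n = aeval α u := fun x ↦ by
    obtain ⟨n, P, hP⟩ := hpow x
    obtain ⟨d, u, hd, hu⟩ := exists_integer_polynomial_smul (A := A) P
    refine ⟨d, n, u, hd, ?_⟩
    rw [hP, ← aeval_map_algebraMap K α u, hu, ← Algebra.smul_def, ← algebraMap_smul K d P,
      map_smul, algebraMap_smul]
  choose d n u hd0 hd using hden
  obtain ⟨s, hs⟩ := Algebra.FiniteType.out (R := A) (A := B)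
  -- The leading coefficient permits pseudo-division by `F`; the factors `d (β x)` are the
  -- denominators of the `p`-powers of the generators.
  obtain ⟨κ, _, ψ, hψ, hκ⟩ := H F hFdeg hFsep (F.leadingCoeff * ∏ x ∈ s, d (β x))
    (mul_ne_zero (leadingCoeff_ne_zero.mpr hF0) (Finset.prod_ne_zero_iff.mpr fun x _ ↦ hd0 _))
  let ψ' : A[X] →+* κ := ψ.comp (AdjoinRoot.mk F)
  have hψC : ∀ a, ψ' (C a) = ψ (AdjoinRoot.of F a) := fun a ↦ rfl
  rw [map_mul, map_mul, map_prod, map_prod] at hψ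
  have hψlc : ψ' (C F.leadingCoeff) ≠ 0 := left_ne_zero_of_mul hψ
  have hψd : ∀ x ∈ s, ψ' (C (d (β x))) ≠ 0 :=
    Finset.prod_ne_zero_iff.mp (right_ne_zero_of_mul hψ)
  let g : A[X] →+* L := (aeval α : A[X] →ₐ[A] L).toRingHom
  have hgC : ∀ a, g (C a) = algebraMap A L a := fun a ↦ aeval_C α a
  have hker : ∀ r, g r = 0 → ψ' r = 0 := fun r hr ↦ by
    refine eq_zero_of_map_dvd_map (K := K) hFdeg ψ' ?_ hψlc r ?_
    · change ψ (AdjoinRoot.mk F F) = 0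
      rw [AdjoinRoot.mk_self, map_zero]
    · rw [hF', hunit.mul_left_dvd]
      refine minpoly.dvd K α ?_
      rw [aeval_map_algebraMap]
      exact hr
  obtain ⟨V, hV, hres⟩ := exists_valuationSubring_forall_mem g ψ' hker
  let gV : A[X] →+* V := g.codRestrict V.toSubring hV
  let ρ : V →+* IsLocalRing.ResidueField V := IsLocalRing.residue V
  let θ : A →+* IsLocalRing.ResidueField V := (ρ.comp gV).comp C
  have hθ : ∀ a, θ a = 0 ↔ ψ' (C a) = 0 := fun a ↦ hres (C a)
  let k := Subfield.closure (θ.range : Set (IsLocalRing.ResidueField V))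
  have hθk : ∀ a, θ a ∈ k := fun a ↦ Subfield.subset_closure ⟨a, rfl⟩
  -- `ρ ∘ gV` and `ψ'` have the same kernel, so each relation `r * b = a` valid in `κ` transfers to
  -- the residue field of `V`.
  have hρk : ∀ r, ρ (gV r) ∈ k := fun r ↦ by
    obtain ⟨a, b, hb, hab⟩ := hκ (ψ' r)
    have h0 : ρ (gV (r * C b - C a)) = 0 := (hres _).mpr <| by
      rw [map_sub, map_mul, hψC, hψC, hab, sub_self]
    have hb' : θ b ≠ 0 := (hθ b).not.mpr hb
    have h1 : ρ (gV r) * θ b = θ a := by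
      rw [map_sub, map_sub, map_mul, map_mul] at h0
      exact sub_eq_zero.mp h0
    rw [eq_div_of_mul_eq hb' h1]
    exact div_mem (hθk a) (hθk b)
  have hexpV : ExpChar V p := by
    have : ExpChar L p := expChar_of_injective_algebraMap (algebraMap K L).injective p
    exact V.subtype.expChar Subtype.val_injective p
  have hgen : ∀ x : B, ∃ hx : β x ∈ V,
      ρ ⟨β x, hx⟩ ∈ perfectClosure k (IsLocalRing.ResidueField V) := fun x ↦ by
    have hx : x ∈ Algebra.adjoin A (s : Set B) := hs ▸ Algebra.mem_top
    induction hx using Algebra.adjoin_induction with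
    | mem x hx =>
      have hdu : IsUnit (gV (C (d (β x)))) := by
        rw [← IsLocalRing.residue_ne_zero_iff_isUnit]
        exact (hθ _).not.mpr (hψd x hx)
      obtain ⟨v, hv⟩ := hdu.exists_right_inv
      have hvL : algebraMap A L (d (β x)) * (v : L) = 1 := by
        have := congrArg Subtype.val hv
        rw [← hgC]
        exact this
      have hpowV : β x ^ p ^ n (β x) = ((v * gV (u (β x)) : V) : L) := by
        change _ = (v : L) * aeval α (u (β x))
        rw [← hd (β x), ← mul_assoc, mul_comm (v : L), hvL, one_mul]
      have hxV : β x ∈ V := ValuationSubring.mem_of_pow_mem V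
        (pow_ne_zero _ (expChar_pos K p).ne') (hpowV ▸ SetLike.coe_mem _)
      refine ⟨hxV, mem_perfectClosure_of_pow_mem p _ (n (β x)) ?_⟩
      have he : (⟨β x, hxV⟩ : V) ^ p ^ n (β x) = v * gV (u (β x)) := Subtype.ext hpowV
      rw [← map_pow, he, map_mul]
      have hv' : θ (d (β x)) * ρ v = 1 := by
        have := congrArg ρ hv
        rwa [map_mul, map_one] at this
      have hvk : ρ v ∈ k := by
        rw [eq_inv_of_mul_eq_one_right hv']
        exact inv_mem (hθk _)
      exact ⟨⟨_, mul_mem hvk (hρk _)⟩, rfl⟩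
    | algebraMap a =>
      have hm : β (algebraMap A B a) = g (C a) := by rw [β.commutes, hgC]
      refine ⟨hm ▸ hV _, ?_⟩
      have he : (⟨β (algebraMap A B a), hm ▸ hV _⟩ : V) = gV (C a) := Subtype.ext hm
      rw [he]
      exact (perfectClosure k _).algebraMap_mem ⟨θ a, hθk a⟩
    | add x y _ _ hx hy =>
      obtain ⟨hx, hx'⟩ := hx
      obtain ⟨hy, hy'⟩ := hy
      have hm : β (x + y) = β x + β y := map_add β x y
      refine ⟨hm ▸ add_mem hx hy, ?_⟩
      have he : (⟨β (x + y), hm ▸ add_mem hx hy⟩ : V) = ⟨β x, hx⟩ + ⟨β y, hy⟩ := Subtype.ext hm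
      rw [he, map_add]
      exact add_mem hx' hy'
    | mul x y _ _ hx hy =>
      obtain ⟨hx, hx'⟩ := hx
      obtain ⟨hy, hy'⟩ := hy
      have hm : β (x * y) = β x * β y := map_mul β x y
      refine ⟨hm ▸ mul_mem hx hy, ?_⟩
      have he : (⟨β (x * y), hm ▸ mul_mem hx hy⟩ : V) = ⟨β x, hx⟩ * ⟨β y, hy⟩ := Subtype.ext hm
      rw [he, map_mul]
      exact mul_mem hx' hy'
  let βV : B →+* V := β.toRingHom.codRestrict V.toSubring fun x ↦ (hgen x).1
  let φ : B →+* perfectClosure k (IsLocalRing.ResidueField V) :=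
    (ρ.comp βV).codRestrict (perfectClosure k (IsLocalRing.ResidueField V)).toSubring
      fun x ↦ (hgen x).2
  have hφ : ∀ a, (φ (algebraMap A B a) : IsLocalRing.ResidueField V) = θ a := fun a ↦
    congrArg ρ (Subtype.ext ((β.commutes a).trans (hgC a).symm) : βV (algebraMap A B a) = gV (C a))
  -- The exponential characteristic `q` of the residue field can differ from `p`.
  obtain ⟨q, _⟩ := ExpChar.exists k
  have : ExpChar (perfectClosure k (IsLocalRing.ResidueField V)) q :=
    expChar_of_injective_algebraMap (algebraMap k _).injective q
  refine ⟨_, inferInstance, q, this, φ, fun w ↦ ?_⟩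
  obtain ⟨m, y, hy⟩ := IsPurelyInseparable.pow_mem k q w
  have hyw : ((w ^ q ^ m : perfectClosure k (IsLocalRing.ResidueField V)) :
      IsLocalRing.ResidueField V) = y := by rw [← hy]; rfl
  obtain ⟨_, ha, _, hb, hab⟩ := Subfield.mem_closure_iff.mp y.2
  rw [Subring.closure_eq] at ha hb
  obtain ⟨a, rfl⟩ := ha
  obtain ⟨b, rfl⟩ := hb
  -- Elements of the closure are quotients `θ a / θ b` with `θ b = 0` allowed; such a quotient is
  -- `0` by convention and is rewritten as `0 / 1`.
  rcases eq_or_ne (θ b) 0 with h0 | h0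
  · refine ⟨m, 0, 1, by simp, Subtype.ext ?_⟩
    rw [map_one, map_one, mul_one, map_zero, map_zero, hyw, ← hab, h0, div_zero]
    rfl
  · refine ⟨m, a, b, fun h ↦ h0 (by rw [← hφ, h]; rfl), Subtype.ext ?_⟩
    rw [MulMemClass.coe_mul, hyw, hφ, hφ, ← hab, div_mul_cancel₀ _ h0]

/-! ### Poonen rings have dense liftable sets -/

lemma isPurelyInseparable_of_comp {F E E' : Type*} [Field F] [Field E] [Field E']
    (φ : F →+* E) (j : E →+* E') (h : (j.comp φ).IsPurelyInseparable) :
    φ.IsPurelyInseparable := by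
  obtain ⟨q, _⟩ := ExpChar.exists F
  rw [isPurelyInseparable_ringHom_iff_pow_mem _ q] at h ⊢
  intro x
  obtain ⟨n, y, hy⟩ := h (j x)
  exact ⟨n, y, j.injective (by rw [map_pow, ← hy]; rfl)⟩

lemma mem_qRelPts_of_comp {X Y S : Scheme.{u}} (i : X ⟶ Y) (f : Y ⟶ S) {x : X}
    (hx : x ∈ QRelPts (i ≫ f)) : i x ∈ QRelPts f := by
  change ((i ≫ f).residueFieldMap x).hom.IsPurelyInseparable at hx
  rw [Scheme.residueFieldMap_comp] at hx
  exact isPurelyInseparable_of_comp _ _ hx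

lemma exists_basicOpen_subset {A : Type u} [CommRing A] [IsDomain A]
    {W : Set (Spec (.of A))} (hW : IsOpen W) (hne : W.Nonempty) :
    ∃ c : A, c ≠ 0 ∧ (PrimeSpectrum.basicOpen c : Set (PrimeSpectrum A)) ⊆ W := by
  obtain ⟨s, hs⟩ := hne
  obtain ⟨_, ⟨c, rfl⟩, hc, hcW⟩ :=
    PrimeSpectrum.isTopologicalBasis_basic_opens.exists_subset_of_mem_open
      (show s ∈ (W : Set (PrimeSpectrum A)) from hs) hW
  refine ⟨c, ?_, hcW⟩
  rintro rfl
  exact hc s.asIdeal.zero_mem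

/-- Clearing denominators in the Bezout identity over `K` leaves a constant `b`, outside whose zero
locus `F` stays separable. -/
lemma exists_bezout_of_isSeparablePoly {A : Type u} [CommRing A] [IsDomain A] {F : A[X]}
    (hF : IsSeparablePoly F) :
    ∃ (b : A) (u v : A[X]), b ≠ 0 ∧ u * F + v * derivative F = C b := by
  let K := FractionRing A
  have hAK : Function.Injective (algebraMap A K) := IsFractionRing.injective A K
  have hs : ∀ (r : A) (P : K[X]), r • P = C (algebraMap A K r) * P := fun r P ↦ by
    rw [← smul_eq_C_mul, algebraMap_smul]
  obtain ⟨u, v, h⟩ := hF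
  obtain ⟨d, u', hd, hu⟩ := exists_integer_polynomial_smul (A := A) u
  obtain ⟨e, v', he, hv⟩ := exists_integer_polynomial_smul (A := A) v
  refine ⟨d * e, C e * u', C d * v', mul_ne_zero hd he, map_injective _ hAK ?_⟩
  rw [hs] at hu hv
  rw [Polynomial.map_add, Polynomial.map_mul, Polynomial.map_mul, Polynomial.map_mul,
    Polynomial.map_mul, map_C, map_C, map_C, ← derivative_map, hu, hv, map_mul, C_mul]
  linear_combination (C (algebraMap A K d) * C (algebraMap A K e)) * h

/-- A purely inseparable residue extension generated by a root of a polynomial which is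
separable at the base point is trivial. -/
lemma mem_relPts_of_mem_qRelPts {A : Type u} [CommRing A] {F : A[X]}
    {b : A} {u v : A[X]} (h : u * F + v * derivative F = C b)
    {y : Spec (.of (AdjoinRoot F))} (hy : y ∈ QRelPts (hypersurfaceMap F))
    (hb : b ∉ (hypersurfaceMap F y).asIdeal) : y ∈ RelPts (hypersurfaceMap F) := by
  let s := hypersurfaceMap F y
  let φ := ((hypersurfaceMap F).residueFieldMap y).hom
  let evs : A →+* (Spec (.of A)).residueField s := (specEval s).hom
  let evy : AdjoinRoot F →+* (Spec (.of (AdjoinRoot F))).residueField y := (specEval y).hom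
  have hnat : ∀ a, φ (evs a) = evy (AdjoinRoot.of F a) := fun a ↦
    congrArg (fun t ↦ t.hom a) (specEval_comp_residueFieldMap (CommRingCat.ofHom (AdjoinRoot.of F)) y)
  have hroot : evy (AdjoinRoot.root F) ∈ φ.range := by
    have hsep : (F.map evs).Separable := by
      have hb' : evs b ≠ 0 := (specEval_ne_zero_iff s b).mpr hb
      have h1 := congrArg (Polynomial.map evs) h
      rw [Polynomial.map_add, Polynomial.map_mul, Polynomial.map_mul, map_C, ← derivative_map] at h1
      refine ⟨C (evs b)⁻¹ * u.map evs, C (evs b)⁻¹ * v.map evs, ?_⟩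
      rw [mul_assoc, mul_assoc, ← mul_add, h1, ← C_mul, inv_mul_cancel₀ hb', C_1]
    change φ.IsPurelyInseparable at hy
    let _ : Algebra ((Spec (.of A)).residueField s)
      ((Spec (.of (AdjoinRoot F))).residueField y) := φ.toAlgebra
    have hpi : IsPurelyInseparable ((Spec (.of A)).residueField s)
      ((Spec (.of (AdjoinRoot F))).residueField y) := hy
    refine hpi.inseparable' _ (hsep.of_dvd (minpoly.dvd _ _ ?_))
    rw [aeval_def, eval₂_map]
    have : (algebraMap ((Spec (.of A)).residueField s)
      ((Spec (.of (AdjoinRoot F))).residueField y)).comp evs = evy.comp (AdjoinRoot.of F) :=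
      RingHom.ext hnat
    rw [this, ← hom_eval₂, AdjoinRoot.eval₂_root, map_zero]
  have hall : ∀ z, evy z ∈ φ.fieldRange := fun z ↦ by
    obtain ⟨P, rfl⟩ := AdjoinRoot.mk_surjective z
    induction P using Polynomial.induction_on' with
    | add P Q hP hQ => rw [map_add, map_add]; exact add_mem hP hQ
    | monomial n a =>
      rw [← C_mul_X_pow_eq_monomial, map_mul, map_mul, map_pow, map_pow]
      exact mul_mem ⟨evs a, hnat a⟩ (pow_mem hroot n)
  refine ⟨φ.injective, fun w ↦ ?_⟩
  obtain ⟨a, b, hb, hw⟩ := exists_specEval_mul_eq y w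
  have : w ∈ φ.fieldRange := by
    rw [eq_div_of_mul_eq hb hw]
    exact div_mem (hall a) (hall b)
  exact this

lemma dense_relSet_of_isPoonenRing {A : Type u} [CommRing A] [IsDomain A] (hA : IsPoonenRing A)
    {F : A[X]} (hdeg : F.natDegree ≠ 0) (hF : IsSeparablePoly F) :
    Dense (RelSet (hypersurfaceMap F)) := by
  obtain ⟨b, u, v, hb, huv⟩ := exists_bezout_of_isSeparablePoly hF
  have hinj : Function.Injective (AdjoinRoot.of F) :=
    AdjoinRoot.of.injective_of_degree_ne_zero fun h ↦ hdeg (natDegree_eq_of_degree_eq_some h)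
  have hfp : LocallyOfFinitePresentation (hypersurfaceMap F) := by
    rw [hypersurfaceMap, LocallyOfFinitePresentation.SpecMap_iff]
    exact RingHom.finitePresentation_algebraMap.mpr
      (inferInstance : Algebra.FinitePresentation A (AdjoinRoot F))
  have hdom : IsDominant (hypersurfaceMap F) := by
    refine ⟨?_⟩
    refine (PrimeSpectrum.denseRange_comap_iff_ker_le_nilRadical (AdjoinRoot.of F)).mpr ?_
    rw [(RingHom.injective_iff_ker_eq_bot _).mp hinj]
    exact bot_le
  rw [dense_iff_inter_open]
  intro W hW hWne
  obtain ⟨c, hc, hcW⟩ := exists_basicOpen_subset hW hWne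
  -- `c` keeps the point inside `W`; `b` keeps `F` separable there.
  let U : (Spec (.of A)).Opens := PrimeSpectrum.basicOpen (c * b)
  have hU : (U : Set (Spec (.of A))).Nonempty :=
    ⟨(⊥ : PrimeSpectrum A), fun h ↦ mul_ne_zero hc hb h⟩
  have : QuasiCompact (hypersurfaceMap F) := by rw [hypersurfaceMap]; infer_instance
  have : QuasiSeparated (hypersurfaceMap F) := by rw [hypersurfaceMap]; infer_instance
  obtain ⟨-, x, hx, -⟩ := hA U hU _ (hypersurfaceMap F ∣_ U)
    ⟨inferInstance, inferInstance, inferInstance⟩ (IsZariskiLocalAtTarget.restrict hdom U)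
  rw [← qRelPts_comp_openImmersion _ U.ι, morphismRestrict_ι] at hx
  have hy := mem_qRelPts_of_comp _ _ hx
  have hyU : hypersurfaceMap F ((hypersurfaceMap F ⁻¹ᵁ U).ι x) ∈ U := x.2
  have hcb : c ∉ (hypersurfaceMap F ((hypersurfaceMap F ⁻¹ᵁ U).ι x)).asIdeal ∧
      b ∉ (hypersurfaceMap F ((hypersurfaceMap F ⁻¹ᵁ U).ι x)).asIdeal := by
    have : c * b ∉ (hypersurfaceMap F ((hypersurfaceMap F ⁻¹ᵁ U).ι x)).asIdeal := hyU
    exact ⟨fun h ↦ this (Ideal.mul_mem_right _ _ h), fun h ↦ this (Ideal.mul_mem_left _ _ h)⟩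
  exact ⟨_, hcW hcb.1, _, mem_relPts_of_mem_qRelPts huv hy hcb.2, rfl⟩

/-! ### Dense liftable sets imply Poonen -/

lemma exists_hom_of_dense_relSet {A : Type u} [CommRing A] [IsDomain A] {F : A[X]}
    (h : Dense (RelSet (hypersurfaceMap F))) {c : A} (hc : c ≠ 0) :
    ∃ (κ : Type u) (_ : Field κ) (ψ : AdjoinRoot F →+* κ), ψ (AdjoinRoot.of F c) ≠ 0 ∧
        ∀ w : κ, ∃ a b : A, ψ (AdjoinRoot.of F b) ≠ 0 ∧
          w * ψ (AdjoinRoot.of F b) = ψ (AdjoinRoot.of F a) := by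
  obtain ⟨-, hs, y, hy, rfl⟩ := h.inter_open_nonempty _ (PrimeSpectrum.basicOpen c).isOpen
    ⟨(⊥ : PrimeSpectrum A), fun h ↦ hc h⟩
  have hnat : ∀ a, ((hypersurfaceMap F).residueFieldMap y).hom
      ((specEval (hypersurfaceMap F y)).hom a) = (specEval y).hom (AdjoinRoot.of F a) := fun a ↦
    congrArg (fun t ↦ t.hom a) (specEval_comp_residueFieldMap (CommRingCat.ofHom (AdjoinRoot.of F)) y)
  refine ⟨(Spec (.of (AdjoinRoot F))).residueField y, inferInstance, (specEval y).hom, ?_,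
    fun w ↦ ?_⟩
  · rw [← hnat, _root_.map_ne_zero]
    exact (specEval_ne_zero_iff (R := .of A) _ c).mpr hs
  · obtain ⟨w, rfl⟩ := hy.2 w
    obtain ⟨a, b, hb, hw⟩ := exists_specEval_mul_eq _ w
    refine ⟨a, b, ?_, ?_⟩
    · rw [← hnat, _root_.map_ne_zero]
      exact hb
    · rw [← hnat, ← hnat, ← map_mul, hw]

lemma isPoonenRing_of_forall_dense {A : Type u} [CommRing A] [IsDomain A]
    (h : ∀ F : A[X], F.natDegree ≠ 0 → IsSeparablePoly F →
      Dense (RelSet (hypersurfaceMap F))) : IsPoonenRing A := by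
  intro U hU X f hf hdom
  have := hf.locallyOfFinitePresentation
  have := hf.quasiCompact
  obtain ⟨c, hc, hcU⟩ := exists_basicOpen_subset U.isOpen hU
  have hirr : IrreducibleSpace (Spec (.of A)) := inferInstanceAs (IrreducibleSpace (PrimeSpectrum A))
  let D : (Spec (.of A)).Opens := PrimeSpectrum.basicOpen c
  have hDne : (D : Set (Spec (.of A))).Nonempty := ⟨(⊥ : PrimeSpectrum A), fun h ↦ hc h⟩
  have hDdense : Dense (D : Set (Spec (.of A))) := D.isOpen.dense hDne
  have : IsDominant U.ι := Opens.isDominant_ι (U.isOpen.dense hU)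
  let V : X.Opens := (f ≫ U.ι) ⁻¹ᵁ D
  -- Since `D(c) ⊆ U`, the open set `D(c)` stays quasi-compact in `U`, and `f` is quasi-compact.
  -- Hence one affine scheme `Y` can surject onto `V`.
  have hVc : IsCompact (V : Set X) := by
    have hDc : IsCompact ((U.ι ⁻¹ᵁ D : U.toScheme.Opens) : Set U) := by
      refine U.ι.isOpenEmbedding.isInducing.isCompact_preimage_iff ?_ |>.mpr
        (PrimeSpectrum.isCompact_basicOpen c)
      rw [Scheme.Opens.range_ι]
      exact hcU
    exact f.isCompact_preimage hDc
  have : CompactSpace V := isCompact_iff_compactSpace.mp hVc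
  have : IsZariskiLocalAtSource @LocallyOfFiniteType.{u} :=
    HasRingHomProperty.instIsZariskiLocalAtSource (P := @LocallyOfFiniteType)
  have : MorphismProperty.ContainsIdentities @LocallyOfFiniteType.{u} :=
    ⟨fun _ ↦ inferInstance⟩
  obtain ⟨Y, p, hp, hpft, hY⟩ :=
    V.toScheme.exists_hom_isAffine_of_isZariskiLocalAtSource @LocallyOfFiniteType
  let g : Spec Γ(Y, ⊤) ⟶ X := Y.isoSpec.inv ≫ p ≫ V.ι
  obtain ⟨φ, hφ⟩ := Spec.map_surjective (g ≫ f ≫ U.ι)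
  have hft : φ.hom.FiniteType := by
    rw [← HasRingHomProperty.Spec_iff (P := @LocallyOfFiniteType), hφ]
    infer_instance
  have hinj : Function.Injective φ.hom := by
    have hd : DenseRange (g ≫ f ≫ U.ι) := by
      -- The image of `Y` is the part of the image of `X` over `D(c)`: a dense set meets a dense
      -- open set densely, so domination survives.
      have hr : Set.range (g ≫ f ≫ U.ι) = Set.range (f ≫ U.ι) ∩ D := by
        have hs : Function.Surjective (Y.isoSpec.inv ≫ p) := (Y.isoSpec.inv ≫ p).surjective
        have : g ≫ f ≫ U.ι = (Y.isoSpec.inv ≫ p) ≫ V.ι ≫ f ≫ U.ι := by simp [g]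
        rw [this, Scheme.Hom.comp_base, TopCat.coe_comp, hs.range_comp, Scheme.Hom.comp_base,
          TopCat.coe_comp, Set.range_comp, Scheme.Opens.range_ι]
        exact Set.image_preimage_eq_range_inter (f := ⇑(f ≫ U.ι))
          (t := (D : Set (Spec (.of A))))
      rw [DenseRange, hr]
      exact (f ≫ U.ι).denseRange.inter_of_isOpen_right hDdense D.isOpen
    rw [← hφ] at hd
    have hk := (PrimeSpectrum.denseRange_comap_iff_ker_le_nilRadical φ.hom).mp hd
    rw [nilradical_eq_zero] at hk
    exact (RingHom.injective_iff_ker_eq_bot _).mpr (le_bot_iff.mp hk)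
  let _ : Algebra A Γ(Y, ⊤) := φ.hom.toAlgebra
  have : Algebra.FiniteType A Γ(Y, ⊤) := hft
  obtain ⟨Ω, _, q, _, χ, hχ⟩ := exists_hom_purelyInseparable (A := A) (B := Γ(Y, ⊤)) hinj
    fun F hdeg hF c hc ↦ exists_hom_of_dense_relSet (h F hdeg hF) hc
  have hne := qRelPts_nonempty_of_fieldPoint (f ≫ U.ι) q (Spec.map (CommRingCat.ofHom χ) ≫ g)
    (φ ≫ CommRingCat.ofHom χ) (by rw [Category.assoc, ← hφ, Spec.map_comp]) hχ
  rw [qRelPts_comp_openImmersion] at hne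
  exact hne.image f

end PoonenScheme

theorem proposition4p1p4 {A : Type u} [CommRing A] [IsDomain A] :
    PoonenScheme.IsPoonenRing A ↔
      ∀ F : Polynomial A, F.natDegree ≠ 0 → PoonenScheme.IsSeparablePoly F →
        Dense (PoonenScheme.RelSet (PoonenScheme.hypersurfaceMap F)) :=
  ⟨fun hA _ hdeg hF ↦ PoonenScheme.dense_relSet_of_isPoonenRing hA hdeg hF,
    PoonenScheme.isPoonenRing_of_forall_dense⟩
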